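/- Let $R$ be a commutative semi-local ring (finitely many maximal ideals) in which $2$ is invertible. A quadratic space over $R$ is a pair $(V,q)$ with $V$ a free $R$-module of finite rank and $q$ a quadratic form on $V$ that is non-degenerate, i.e. such that $V\to V^*$, $v\mapsto b_q(v,-)$, is bijective, where $b_q(v,w)=q(v+w)-q(v)-q(w)$. A vector $v\in V$ is unimodular if it generates a free direct summand of rank one, i.e. $\varphi(v)=1$ for some $\varphi\in V^*$; it is isotropic if it is unimodular and $q(v)=0$; and $(V,q)$ is isotropic if it has an isotropic vector. A rank-$n$ subspace of $(V,q)$ is a submodule $W\subseteq V$ that is free of rank $n$ and for which $q|_W$ is non-degenerate. For an $R$-algebra $S$, let $q_S$ be the quadratic form on $V_S=S\otimes_R V$ extending $q$. Let $n\ge 2$, let $S$ be a finite étale $R$-algebra of (constant) degree $n$, and let $(V,q)$ be a quadratic space over $R$ of rank greater than $n$ such that $(V_S,q_S)$ is isotropic. Then: (a) $(V,q)$ has a rank-$n$ subspace $W$ such that $(W_S,(q|_W)_S)$ is isotropic. (b) If $S=R[t]/(f)$, where $f\in R[t]$ has degree $n$ and invertible leading coefficient, and $\theta\in S$ is the image of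 $t$, then there are $v_0,\dots,v_{n-1}\in V$ such that $\sum_{i=0}^{n-1}\theta^i\otimes v_i\in V_S$ is an isotropic vector for $q_S$ and $v_0,\dots,v_{n-1}$ generate a rank-$n$ subspace of $(V,q)$. -/

import Mathlib

open scoped TensorProduct

namespace QuadSpace

variable {R V : Type*} [CommRing R] [AddCommGroup V] [Module R V]

/-- `(V, q)` is a (free) quadratic space: `V` is free of finite rank and `q` is non-degenerate,
i.e. the map `V → V*`, `v ↦ b_q(v, -)`, is bijective, where
`b_q(v, w) = q(v + w) - q(v) - q(w)` is the polar form. -/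
structure IsQuadraticSpace (q : QuadraticForm R V) : Prop where
  free : Module.Free R V
  finite : Module.Finite R V
  nondegenerate :
    Function.Bijective (QuadraticMap.polarBilin q : V → Module.Dual R V)

/-- `v` is unimodular: it generates a free rank-one direct summand, i.e. some linear functional
takes the value `1` at `v`. -/
def IsUnimodular (R : Type*) {V : Type*} [CommRing R] [AddCommGroup V] [Module R V] (v : V) :
    Prop :=
  ∃ φ : Module.Dual R V, φ v = 1

/-- A (strictly) isotropic vector of `q`. -/
def IsIsotropicVector (q : QuadraticForm R V) (v : V) : Prop :=
  IsUnimodular R v ∧ q v = 0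

/-- `(V, q)` is (strictly) isotropic. -/
def IsIsotropic (q : QuadraticForm R V) : Prop :=
  ∃ v : V, IsIsotropicVector q v

/-- The submodule `W` with the restriction of `q` is a subspace of `(V, q)` of rank `n`: it is
free of rank `n`, and `q|_W` is non-degenerate. -/
def IsSubspaceOfRank (q : QuadraticForm R V) (W : Submodule R V) (n : ℕ) : Prop :=
  IsQuadraticSpace (q.restrict W) ∧ Module.finrank R W = n

end QuadSpace

/-! Fix an `R`-basis `e` of `S`. Each vector of `V_S` is `∑ e_i ⊗ v_i` for unique `v_i` in `V`. If
it is isotropic and the Gram matrix of the `v_i` is invertible, their span is the required subspace;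
unimodularity then comes for free. Taking for `e` the powers of `θ` gives (b). So the task is to
move the given isotropic vector `x` to one with unit Gram determinant.

The vector is moved by two successive reflections, along `y` and then `z` in `V_S`, each scaled by
`b(y,y)` resp. `b(z,z)` to avoid denominators. The result is isotropic for every choice of `y`, `z`,
and its Gram determinant is polynomial in their coordinates. By the Chinese remainder theorem it
suffices to make this determinant nonzero over each residue field `k`. If `k` is infinite, it is
enough to do so over the algebraic closure.

There remain finite and algebraically closed fields, over which binary forms are universal, so that
`V` contains every nondegenerate form of rank `n`. One such form on `S` is `Tr(sa)Tr(c) +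
Tr(a)Tr(sc) - 2Tr(sac)` for a suitable `s`. Embedding it and pairing `e` with the images of its
trace-dual basis gives an isotropic `z` with invertible Gram matrix
(`exists_isotropic_isUnit_det_gram`). The scaled reflection along an isotropic `z` sends everything
to multiples of `z`. If the first reflection makes the pairing with `z` a unit
(`exists_isUnit_pairing_refl`), then `x` lands on a unit multiple of `z`. -/

namespace QuadSpace

/-! ### Traces of finite étale algebras over a field -/

section Trace

variable {k : Type*} [Field k]

theorem trace_pi {I : Type*} [Fintype I] [DecidableEq I] (L : I → Type*) [∀ i, CommRing (L i)]
    [∀ i, Algebra k (L i)] [∀ i, Module.Finite k (L i)] (x : ∀ i, L i) :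
    Algebra.trace k (∀ i, L i) x = ∑ i, Algebra.trace k (L i) (x i) := by
  have key : ∀ (i : I) (y : L i),
      Algebra.trace k (∀ i, L i) (Pi.single i y) = Algebra.trace k (L i) y := by
    intro i y
    have h1 : LinearMap.mul k (∀ i, L i) (Pi.single i y) =
        (LinearMap.single k L i) ∘ₗ ((LinearMap.mul k (L i) y) ∘ₗ LinearMap.proj i) := by
      ext j z l
      by_cases hl : l = i
      · subst hl; simp
      · simp [hl]
    have h2 : ((LinearMap.mul k (L i) y) ∘ₗ LinearMap.proj i) ∘ₗ LinearMap.single k L i =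
        LinearMap.mul k (L i) y := by
      ext z; simp
    rw [Algebra.trace_apply, Algebra.trace_apply]
    change LinearMap.trace k _ (LinearMap.mul k _ _) = LinearMap.trace k _ (LinearMap.mul k _ _)
    rw [h1, LinearMap.trace_comp_comm', h2]
  conv_lhs => rw [← Finset.univ_sum_single x, map_sum]
  exact Finset.sum_congr rfl fun i _ => key i (x i)

variable {S : Type*} [CommRing S] [Algebra k S] [Module.Finite k S] [Algebra.Etale k S]

/-- An étale algebra over a field is a product of finite separable extensions, and its trace is the
sum of theirs. Testing against elements supported in one factor reduces the claim to that extension.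
-/
theorem traceForm_nondegenerate_of_etale : (Algebra.traceForm k S).Nondegenerate := by
  classical
  have : IsReduced S := Algebra.FormallyUnramified.isReduced_of_field k S
  have : IsArtinianRing S := isArtinian_of_tower k inferInstance
  have : Fintype (MaximalSpectrum S) := Fintype.ofFinite _
  let e : S ≃ₐ[k] ∀ M : MaximalSpectrum S, S ⧸ M.asIdeal :=
    (IsArtinianRing.equivPi S).restrictScalars k
  let _ : ∀ M : MaximalSpectrum S, Field (S ⧸ M.asIdeal) := fun M => Ideal.Quotient.field _
  have hu : ∀ M : MaximalSpectrum S, Algebra.FormallyUnramified k (S ⧸ M.asIdeal) := fun M =>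
    Algebra.FormallyUnramified.of_surjective (Ideal.Quotient.mkₐ k M.asIdeal)
      (Ideal.Quotient.mkₐ_surjective _ _)
  have hs : ∀ M : MaximalSpectrum S, Algebra.IsSeparable k (S ⧸ M.asIdeal) := fun M =>
    Algebra.FormallyUnramified.isSeparable k (S ⧸ M.asIdeal)
  have htr : ∀ s : S, Algebra.trace k S s =
      ∑ M : MaximalSpectrum S, Algebra.trace k (S ⧸ M.asIdeal) (e s M) := fun s => by
    rw [← Algebra.trace_eq_of_algEquiv e, trace_pi]
  refine (LinearMap.IsRefl.nondegenerate_iff_separatingLeft (B := Algebra.traceForm k S)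
    (Algebra.traceForm_isSymm k).isRefl).2 fun a ha => ?_
  apply e.injective
  rw [map_zero]
  funext M
  refine (traceForm_nondegenerate k (S ⧸ M.asIdeal)).1 _ fun c => ?_
  have := ha (e.symm (Pi.single M c))
  rw [Algebra.traceForm_apply, htr] at this
  rw [Algebra.traceForm_apply, ← this, Finset.sum_eq_single M]
  · simp
  · intro M' _ hM
    simp [Pi.single_eq_of_ne hM]
  · simp

theorem exists_ne_zero_trace_eq {L : Type*} [Field L] [Algebra k L] [Module.Finite k L]
    [Algebra.IsSeparable k L] (h : 2 ≤ Module.finrank k L) (c : k) :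
    ∃ u : L, u ≠ 0 ∧ Algebra.trace k L u = c := by
  by_cases hc : c = 0
  · subst hc
    have := LinearMap.finrank_range_add_finrank_ker (Algebra.trace k L)
    have h1 : Module.finrank k (LinearMap.range (Algebra.trace k L)) ≤ 1 := by
      simpa using Submodule.finrank_le (LinearMap.range (Algebra.trace k L))
    have h2 : 0 < Module.finrank k (LinearMap.ker (Algebra.trace k L)) := by omega
    have := Module.finrank_pos_iff.1 h2
    obtain ⟨u, hu⟩ := exists_ne (0 : LinearMap.ker (Algebra.trace k L))
    exact ⟨u, fun h => hu (Subtype.ext h), u.2⟩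
  · obtain ⟨u, hu⟩ := Algebra.trace_surjective k L c
    exact ⟨u, fun h => hc (by rw [← hu, h, map_zero]), hu⟩

/-- Supplies the parameter `s` of the twisted trace form when `n = 1` in `k`. A factor of degree at
least 2 contains nonzero elements of any prescribed trace, so it can absorb the trace of the others.
Otherwise `S` is split and a unit is written down by hand. -/
theorem exists_isUnit_trace_eq_zero (h2 : (2 : k) ≠ 0) (hn : 2 ≤ Module.finrank k S)
    (h1 : (Module.finrank k S : k) = 1) : ∃ s : S, IsUnit s ∧ Algebra.trace k S s = 0 := by
  classical
  have : IsReduced S := Algebra.FormallyUnramified.isReduced_of_field k S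
  have : IsArtinianRing S := isArtinian_of_tower k inferInstance
  have : Fintype (MaximalSpectrum S) := Fintype.ofFinite _
  let e : S ≃ₐ[k] ∀ M : MaximalSpectrum S, S ⧸ M.asIdeal :=
    (IsArtinianRing.equivPi S).restrictScalars k
  let _ : ∀ M : MaximalSpectrum S, Field (S ⧸ M.asIdeal) := fun M => Ideal.Quotient.field _
  have hu : ∀ M : MaximalSpectrum S, Algebra.FormallyUnramified k (S ⧸ M.asIdeal) := fun M =>
    Algebra.FormallyUnramified.of_surjective (Ideal.Quotient.mkₐ k M.asIdeal)
      (Ideal.Quotient.mkₐ_surjective _ _)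
  have hs : ∀ M : MaximalSpectrum S, Algebra.IsSeparable k (S ⧸ M.asIdeal) := fun M =>
    Algebra.FormallyUnramified.isSeparable k (S ⧸ M.asIdeal)
  have hrank : Module.finrank k S = ∑ M : MaximalSpectrum S, Module.finrank k (S ⧸ M.asIdeal) := by
    rw [e.toLinearEquiv.finrank_eq, Module.finrank_pi_fintype]
  suffices ∃ u : ∀ M : MaximalSpectrum S, S ⧸ M.asIdeal, (∀ M, u M ≠ 0) ∧
      ∑ M : MaximalSpectrum S, Algebra.trace k (S ⧸ M.asIdeal) (u M) = 0 by
    obtain ⟨u, hu0, hut⟩ := this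
    refine ⟨e.symm u, ?_, ?_⟩
    · exact (Pi.isUnit_iff.2 fun M => (hu0 M).isUnit).map e.symm
    · rw [← Algebra.trace_eq_of_algEquiv e, trace_pi, e.apply_symm_apply, hut]
  by_cases hM : ∃ M : MaximalSpectrum S, 2 ≤ Module.finrank k (S ⧸ M.asIdeal)
  · obtain ⟨M, hM⟩ := hM
    obtain ⟨v, hv, hvt⟩ := exists_ne_zero_trace_eq hM
      (-∑ N ∈ Finset.univ \ {M}, Algebra.trace k (S ⧸ N.asIdeal) 1)
    refine ⟨Function.update 1 M v, fun N => ?_, ?_⟩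
    · by_cases h : N = M
      · subst h; simpa using hv
      · simp [h]
    · rw [← Finset.sum_sdiff (Finset.subset_univ {M}), Finset.sum_singleton,
        Function.update_self, hvt, add_neg_eq_zero]
      refine Finset.sum_congr rfl fun N hN => ?_
      rw [Function.update_of_ne (by simpa using hN)]
      rfl
  · push Not at hM
    have hone : ∀ M : MaximalSpectrum S, Module.finrank k (S ⧸ M.asIdeal) = 1 := fun M => by
      have := hM M
      have : 0 < Module.finrank k (S ⧸ M.asIdeal) := Module.finrank_pos
      omega
    simp only [hone, Finset.sum_const, Finset.card_univ, smul_eq_mul, mul_one] at hrank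
    obtain ⟨M, N, hMN⟩ := Fintype.exists_pair_of_one_lt_card (α := MaximalSpectrum S) (by omega)
    -- The coordinates are 2 at `M`, -1 at `N` and 1 elsewhere, with sum `n - 1 = 0` in `k`; all are
    -- nonzero because 2 is.
    let c : MaximalSpectrum S → k := fun P => 1 + (if P = M then 1 else 0) - (if P = N then 2 else 0)
    refine ⟨fun P => algebraMap k _ (c P), fun P => ?_, ?_⟩
    · rw [Ne, FaithfulSMul.algebraMap_eq_zero_iff]
      by_cases h : P = M
      · subst h
        simp only [c, if_true, if_neg hMN]
        intro h; apply h2; linear_combination h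
      · by_cases h' : P = N
        · simp only [c, h', if_true]
          rw [if_neg hMN.symm]
          intro h; apply one_ne_zero (α := k); linear_combination -h
        · simp [c, h, h']
    · simp only [Algebra.trace_algebraMap, hone, one_smul]
      simp only [c, Finset.sum_sub_distrib, Finset.sum_add_distrib, Finset.sum_ite_eq',
        Finset.mem_univ, if_true, Finset.sum_const, Finset.card_univ, ← hrank, nsmul_eq_mul, h1]
      ring

end Trace

end QuadSpace

namespace QuadSpace

/-! ### Isometric embeddings over fields with universal binary forms -/

section Embedding

variable {k : Type*} [Field k]

/-- Every nondegenerate diagonal binary quadratic form over `k` represents all nonzero scalars. -/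
def BinaryUniversal (k : Type*) [Field k] : Prop :=
  ∀ a b c : k, a ≠ 0 → b ≠ 0 → c ≠ 0 → ∃ u v : k, a * u ^ 2 + b * v ^ 2 = c

theorem binaryUniversal_of_isAlgClosed [IsAlgClosed k] : BinaryUniversal k := by
  intro a b c ha _ _
  obtain ⟨u, hu⟩ := IsAlgClosed.exists_pow_nat_eq (c / a) (n := 2) (by norm_num)
  exact ⟨u, 0, by rw [hu]; field_simp; ring⟩

theorem binaryUniversal_of_finite [Finite k] (h2 : (2 : k) ≠ 0) : BinaryUniversal k := by
  intro a b c ha hb _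
  have := Fintype.ofFinite k
  open Polynomial in
  obtain ⟨u, v, h⟩ := FiniteField.exists_root_sum_quadratic (R := k)
    (f := C a * X ^ 2 + C 0 * X + C (-c)) (g := C b * X ^ 2 + C 0 * X + C 0)
    (degree_quadratic ha) (degree_quadratic hb)
    (FiniteField.odd_card_of_char_ne_two fun h => h2 (by
      have := CharP.cast_eq_zero k (ringChar k)
      rw [h] at this; exact_mod_cast this))
  refine ⟨u, v, ?_⟩
  simp at h
  linear_combination h

/-- Two of the given vectors span a plane representing `g 0`. The orthogonal complement of the
chosen vector in that plane is again anisotropic and replaces both, so each prescribed value costs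
one vector. The surplus vector keeps a plane available at the last step. -/
theorem exists_orthogonal_family (hu : BinaryUniversal k) {V : Type*} [AddCommGroup V] [Module k V]
    (β : LinearMap.BilinForm k V) (hβ : β.IsSymm) (n : ℕ) :
    ∀ (v : Fin (n + 1) → V), (∀ i j, i ≠ j → β (v i) (v j) = 0) → (∀ i, β (v i) (v i) ≠ 0) →
    ∀ g : Fin n → k, (∀ i, g i ≠ 0) →
    ∃ w : Fin n → V, (∀ i, w i ∈ Submodule.span k (Set.range v)) ∧
      ∀ i j, β (w i) (w j) = if i = j then g i else 0 := by
  induction n with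
  | zero => exact fun v _ _ g _ => ⟨Fin.elim0, fun i => i.elim0, fun i => i.elim0⟩
  | succ n ih =>
    intro v hv hv0 g hg
    set a := β (v 0) (v 0) with ha
    set b := β (v 1) (v 1) with hb
    obtain ⟨u, c, huc⟩ := hu a b (g 0) (hv0 0) (hv0 1) (hg 0)
    have h01 : β (v 0) (v 1) = 0 := hv _ _ (by simp)
    have h10 : β (v 1) (v 0) = 0 := hv _ _ (by simp)
    let w0 := u • v 0 + c • v 1
    -- Spans the complement of `w0` in the plane of `v 0` and `v 1`; its value under `β` is `a * b *
    -- g 0`.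
    let v0 := (-(b * c)) • v 0 + (a * u) • v 1
    have hw0 : β w0 w0 = g 0 := by
      simp only [w0, map_add, map_smul, LinearMap.add_apply, LinearMap.smul_apply, smul_eq_mul, h01,
        h10, ← ha, ← hb]
      linear_combination huc
    have hwv0 : β w0 v0 = 0 := by
      simp only [w0, v0, map_add, map_smul, LinearMap.add_apply, LinearMap.smul_apply, smul_eq_mul,
        h01, h10, ← ha, ← hb]
      ring
    have hv00 : β v0 v0 ≠ 0 := by
      have : β v0 v0 = a * b * g 0 := by
        simp only [v0, map_add, map_smul, LinearMap.add_apply, LinearMap.smul_apply, smul_eq_mul,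
          h01, h10, ← ha, ← hb]
        linear_combination a * b * huc
      rw [this]
      exact mul_ne_zero (mul_ne_zero (hv0 0) (hv0 1)) (hg 0)
    have horth : ∀ i : Fin n, β (v 0) (v i.succ.succ) = 0 ∧ β (v 1) (v i.succ.succ) = 0 := fun i =>
      ⟨hv _ _ (Fin.succ_ne_zero _).symm, hv _ _ (by
        rw [← Fin.succ_zero_eq_one, Ne, Fin.succ_inj]; exact (Fin.succ_ne_zero _).symm)⟩
    have hv0i : ∀ i : Fin n, β v0 (v i.succ.succ) = 0 := fun i => by
      simp [v0, (horth i).1, (horth i).2]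
    have hw0i : ∀ i : Fin n, β w0 (v i.succ.succ) = 0 := fun i => by
      simp [w0, (horth i).1, (horth i).2]
    obtain ⟨w, hw, hwg⟩ := ih (Fin.cons v0 fun i => v i.succ.succ) (fun i j => by
        refine Fin.cases ?_ (fun i => ?_) i <;> refine Fin.cases ?_ (fun j => ?_) j
        · simp
        · simp [hv0i]
        · intro _
          rw [hβ.eq]; simp [hv0i]
        · intro h
          simpa using hv _ _ (by simpa using h))
      (fun i => by
        refine Fin.cases ?_ (fun i => ?_) i
        · simpa using hv00
        · simpa using hv0 _) (fun i => g i.succ) fun i => hg _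
    have hperp : ∀ i, β w0 (w i) = 0 := fun i => by
      have : Submodule.span k (Set.range (Fin.cons v0 fun i : Fin n => v i.succ.succ : Fin (n + 1) → V))
          ≤ LinearMap.ker (β w0) := by
        rw [Submodule.span_le]
        rintro _ ⟨j, rfl⟩
        refine Fin.cases ?_ (fun j => ?_) j
        · simpa using hwv0
        · simpa using hw0i j
      exact this (hw i)
    have hmem : ∀ i, v i ∈ Submodule.span k (Set.range v) := fun i =>
      Submodule.subset_span ⟨i, rfl⟩
    refine ⟨Fin.cons w0 w, fun i => ?_, fun i j => ?_⟩
    · refine Fin.cases ?_ (fun i => ?_) i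
      · exact add_mem (Submodule.smul_mem _ _ (hmem _)) (Submodule.smul_mem _ _ (hmem _))
      · refine (Submodule.span_le.2 ?_) (hw i)
        rintro _ ⟨j, rfl⟩
        refine Fin.cases ?_ (fun j => ?_) j
        · exact add_mem (Submodule.smul_mem _ _ (hmem _)) (Submodule.smul_mem _ _ (hmem _))
        · exact hmem _
    · refine Fin.cases ?_ (fun i => ?_) i <;> refine Fin.cases ?_ (fun j => ?_) j
      · simpa using hw0
      · simpa [(Fin.succ_ne_zero _).symm] using hperp j
      · rw [hβ.eq]; simpa using hperp i
      · simpa using hwg i j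

theorem exists_isometric_embedding [Invertible (2 : k)] (hu : BinaryUniversal k)
    {V W : Type*} [AddCommGroup V] [Module k V] [Module.Finite k V]
    [AddCommGroup W] [Module k W] [Module.Finite k W]
    (β : LinearMap.BilinForm k V) (hβ : β.IsSymm) (hβ' : β.Nondegenerate)
    (γ : LinearMap.BilinForm k W) (hγ : γ.IsSymm) (hγ' : γ.Nondegenerate)
    (hVW : Module.finrank k W < Module.finrank k V) :
    ∃ L : W →ₗ[k] V, ∀ a c, β (L a) (L c) = γ a c := by
  obtain ⟨v, hv⟩ := LinearMap.BilinForm.exists_orthogonal_basis (B := β) ⟨hβ.eq⟩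
  obtain ⟨w, hw⟩ := LinearMap.BilinForm.exists_orthogonal_basis (B := γ) ⟨hγ.eq⟩
  have hv0 := hv.not_isOrtho_basis_self_of_separatingLeft hβ'.1
  have hw0 := hw.not_isOrtho_basis_self_of_separatingLeft hγ'.1
  rw [LinearMap.isOrthoᵢ_def] at hv hw
  obtain ⟨w', -, hw'⟩ := exists_orthogonal_family hu β hβ (Module.finrank k W)
    (fun i => v (Fin.castLE hVW i)) (fun i j hij => hv _ _ (by simpa using hij))
    (fun i => hv0 _) (fun i => γ (w i) (w i)) hw0
  refine ⟨w.constr k w', fun a c => ?_⟩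
  have : β.compl₁₂ (w.constr k w') (w.constr k w') = γ := by
    refine w.ext fun i => w.ext fun j => ?_
    simp only [LinearMap.compl₁₂_apply, Module.Basis.constr_basis, hw']
    split_ifs with h
    · rw [h]
    · exact (hw _ _ h).symm
  exact LinearMap.congr_fun₂ this a c

end Embedding

end QuadSpace

namespace QuadSpace

/-! ### Gram matrices of coefficients, scaled reflections, base change -/

section Gram

variable {R S ι κ : Type*} [CommRing R] [CommRing S] [Algebra R S]
  [Fintype ι] [Fintype κ] [DecidableEq κ]

/-- The bilinear form on `S^κ` with Gram matrix `B` over the base ring `R`. -/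
noncomputable def pairing (B : Matrix κ κ R) (S : Type*) [CommRing S] [Algebra R S] :
    LinearMap.BilinForm S (κ → S) :=
  Matrix.toBilin' (B.map (algebraMap R S))

theorem pairing_apply (B : Matrix κ κ R) (x y : κ → S) :
    pairing B S x y = ∑ a, ∑ b, x a * algebraMap R S (B a b) * y b := by
  simp [pairing, Matrix.toBilin'_apply]

theorem pairing_symm {B : Matrix κ κ R} (hB : B.IsSymm) (x y : κ → S) :
    pairing B S x y = pairing B S y x := by
  rw [pairing_apply, pairing_apply, Finset.sum_comm]
  refine Finset.sum_congr rfl fun a _ => Finset.sum_congr rfl fun b _ => ?_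
  rw [hB.apply]; ring

/-- The coefficients of `x ∈ S^κ` in an `R`-basis of `S`. -/
noncomputable def coeffMatrix (e : Module.Basis ι R S) (x : κ → S) : Matrix κ ι R :=
  Matrix.of fun a i => e.repr (x a) i

/-- The Gram matrix of the coefficients `v_i ∈ R^κ` of `x = ∑ e_i ⊗ v_i`. -/
noncomputable def gram (e : Module.Basis ι R S) (B : Matrix κ κ R) (x : κ → S) : Matrix ι ι R :=
  (coeffMatrix e x).transpose * B * coeffMatrix e x

theorem gram_apply (e : Module.Basis ι R S) (B : Matrix κ κ R) (x : κ → S) (i j : ι) :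
    gram e B x i j = ∑ a, ∑ b, e.repr (x a) i * B a b * e.repr (x b) j := by
  simp only [gram, Matrix.mul_apply, coeffMatrix, Matrix.of_apply, Matrix.transpose_apply,
    Finset.sum_mul]
  exact Finset.sum_comm

theorem pairing_self_eq_sum_gram (e : Module.Basis ι R S) (B : Matrix κ κ R) (x : κ → S) :
    pairing B S x x = ∑ i, ∑ j, gram e B x i j • (e i * e j) := by
  have hx : ∀ a, x a = ∑ i, e.repr (x a) i • e i := fun a => (e.sum_repr (x a)).symm
  rw [pairing_apply]
  simp only [gram_apply, Finset.sum_smul]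
  calc _ = ∑ a, ∑ b, ∑ i, ∑ j, (e.repr (x a) i * B a b * e.repr (x b) j) • (e i * e j) := by
        refine Finset.sum_congr rfl fun a _ => Finset.sum_congr rfl fun b _ => ?_
        conv_lhs => rw [hx a, hx b]
        rw [Finset.sum_mul, Finset.sum_mul]
        refine Finset.sum_congr rfl fun i _ => ?_
        rw [Finset.mul_sum]
        refine Finset.sum_congr rfl fun j _ => ?_
        simp only [Algebra.smul_def, map_mul]
        ring
    _ = ∑ a, ∑ i, ∑ j, ∑ b, (e.repr (x a) i * B a b * e.repr (x b) j) • (e i * e j) := by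
        refine Finset.sum_congr rfl fun a _ => ?_
        rw [Finset.sum_comm]
        exact Finset.sum_congr rfl fun i _ => Finset.sum_comm
    _ = _ := by
        rw [Finset.sum_comm]
        refine Finset.sum_congr rfl fun i _ => ?_
        rw [Finset.sum_comm]

/-- Multiplication by `s` acts on coefficients through its regular representation, so the Gram
matrix changes by a congruence with an invertible matrix. -/
theorem isUnit_det_gram_smul [DecidableEq ι] (e : Module.Basis ι R S) (B : Matrix κ κ R)
    (x : κ → S) {s : S} (hs : IsUnit s) (hx : IsUnit (gram e B x).det) :
    IsUnit (gram e B (s • x)).det := by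
  have hM : coeffMatrix e (s • x) = coeffMatrix e x * (Algebra.leftMulMatrix e s).transpose := by
    ext a i
    have := congrFun (Algebra.leftMulMatrix_mulVec_repr e s (x a)) i
    simp only [coeffMatrix, Matrix.of_apply, Pi.smul_apply, smul_eq_mul, ← this, Matrix.mul_apply,
      Matrix.transpose_apply, Matrix.mulVec, dotProduct]
    exact Finset.sum_congr rfl fun j _ => mul_comm _ _
  have : gram e B (s • x) = Algebra.leftMulMatrix e s * gram e B x *
      (Algebra.leftMulMatrix e s).transpose := by
    simp only [gram, hM, Matrix.transpose_mul, Matrix.transpose_transpose, Matrix.mul_assoc]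
  have hu : IsUnit (Algebra.leftMulMatrix e s).det :=
    (Matrix.isUnit_iff_isUnit_det _).1 (hs.map (Algebra.leftMulMatrix e))
  rw [this, Matrix.det_mul, Matrix.det_mul, Matrix.det_transpose]
  exact (hu.mul hx).mul hu

/-- An invertible Gram matrix lets one prescribe the values of a functional over `R` on the
coefficient vectors. Prescribing the coordinates of 1 makes its scalar extension take the value 1 at
`x`. -/
theorem exists_dotProduct_eq_one_of_isUnit_det_gram [DecidableEq ι] (e : Module.Basis ι R S)
    (B : Matrix κ κ R) (x : κ → S) (hx : IsUnit (gram e B x).det) :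
    ∃ φ : κ → S, φ ⬝ᵥ x = 1 := by
  let c : ι → R := fun i => e.repr 1 i
  let r : κ → R := B.mulVec ((coeffMatrix e x).mulVec ((gram e B x)⁻¹.mulVec c))
  have hr : (coeffMatrix e x).transpose.mulVec r = c := by
    simp only [r, Matrix.mulVec_mulVec, ← Matrix.mul_assoc]
    change (gram e B x * (gram e B x)⁻¹).mulVec c = c
    rw [Matrix.mul_nonsing_inv _ hx, Matrix.one_mulVec]
  refine ⟨fun a => algebraMap R S (r a), ?_⟩
  apply e.repr.injective
  ext i
  change _ = c i
  rw [← congrFun hr i]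
  simp only [dotProduct, ← Algebra.smul_def, map_sum, map_smul, Finsupp.coe_finsetSum,
    Finset.sum_apply, Finsupp.smul_apply, smul_eq_mul, Matrix.mulVec, Matrix.transpose_apply,
    coeffMatrix, Matrix.of_apply]
  exact Finset.sum_congr rfl fun a _ => mul_comm _ _

/-- A multiple of the reflection of `x` along `y`. -/
noncomputable def refl (B : Matrix κ κ R) (x y : κ → S) : κ → S :=
  pairing B S y y • x - (2 * pairing B S x y) • y

theorem pairing_refl_self {B : Matrix κ κ R} (hB : B.IsSymm) {x : κ → S}
    (hx : pairing B S x x = 0) (y : κ → S) : pairing B S (refl B x y) (refl B x y) = 0 := by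
  simp only [refl, map_sub, map_smul, LinearMap.sub_apply, LinearMap.smul_apply, smul_eq_mul, hx,
    pairing_symm hB y x]
  ring

/-- Without division by `b(y,y)`, the scaled reflection makes sense for isotropic `y`, where it
degenerates to a map onto multiples of `y`. -/
theorem refl_of_pairing_self_eq_zero {B : Matrix κ κ R} (x : κ → S) {y : κ → S}
    (hy : pairing B S y y = 0) : refl B x y = (-(2 * pairing B S x y)) • y := by
  rw [refl, hy, zero_smul, zero_sub, neg_smul]

theorem pairing_refl {B : Matrix κ κ R} (x y z : κ → S) :
    pairing B S (refl B x y) z =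
      pairing B S y y * pairing B S x z - 2 * pairing B S x y * pairing B S y z := by
  simp [refl]

section Naturality

variable {R' S' : Type*} [CommRing R'] [CommRing S'] [Algebra R' S'] (φ : R →+* R') (ψ : S →+* S')

theorem pairing_map (h : ∀ r, ψ (algebraMap R S r) = algebraMap R' S' (φ r)) (B : Matrix κ κ R)
    (x y : κ → S) :
    pairing (B.map φ) S' (fun a => ψ (x a)) (fun a => ψ (y a)) = ψ (pairing B S x y) := by
  simp [pairing_apply, map_sum, h]

theorem refl_map (h : ∀ r, ψ (algebraMap R S r) = algebraMap R' S' (φ r)) (B : Matrix κ κ R)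
    (x y : κ → S) :
    refl (B.map φ) (fun a => ψ (x a)) (fun a => ψ (y a)) = fun a => ψ (refl B x y a) := by
  funext a
  simp [refl, pairing_map φ ψ h, map_ofNat]

theorem repr_map (h : ∀ r, ψ (algebraMap R S r) = algebraMap R' S' (φ r))
    (e : Module.Basis ι R S) (e' : Module.Basis ι R' S') (he : ∀ i, ψ (e i) = e' i) (s : S) (i : ι) :
    e'.repr (ψ s) i = φ (e.repr s i) := by
  classical
  conv_lhs => rw [← e.sum_repr s]
  simp only [Algebra.smul_def, map_sum, map_mul, h, he]
  simp only [← Algebra.smul_def, map_smul, Finsupp.coe_finsetSum, Finset.sum_apply,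
    Finsupp.smul_apply, Module.Basis.repr_self, Finsupp.single_apply, smul_eq_mul, mul_ite, mul_one,
    mul_zero, Finset.sum_ite_eq', Finset.mem_univ, if_true]

theorem gram_map (h : ∀ r, ψ (algebraMap R S r) = algebraMap R' S' (φ r))
    (e : Module.Basis ι R S) (e' : Module.Basis ι R' S') (he : ∀ i, ψ (e i) = e' i)
    (B : Matrix κ κ R) (x : κ → S) :
    gram e' (B.map φ) (fun a => ψ (x a)) = (gram e B x).map φ := by
  ext i j
  simp [gram_apply, repr_map φ ψ h e e' he, map_sum]

/-- Allows the determinant to be tested modulo maximal ideals and specialised from generic `y`, `z`.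
-/
theorem det_gram_map [DecidableEq ι] (h : ∀ r, ψ (algebraMap R S r) = algebraMap R' S' (φ r))
    (e : Module.Basis ι R S) (e' : Module.Basis ι R' S') (he : ∀ i, ψ (e i) = e' i)
    (B : Matrix κ κ R) (x y z : κ → S) :
    (gram e' (B.map φ) (refl (B.map φ) (refl (B.map φ) (fun a => ψ (x a)) (fun a => ψ (y a)))
      fun a => ψ (z a))).det = φ (gram e B (refl B (refl B x y) z)).det := by
  rw [refl_map φ ψ h, refl_map φ ψ h, gram_map φ ψ h e e' he, RingHom.map_det]
  rfl

end Naturality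

end Gram

end QuadSpace

namespace QuadSpace

/-! ### The twisted trace form and an isotropic vector built from it -/

section EtaleForm

variable {k S : Type*} [Field k] [CommRing S] [Algebra k S] [Module.Finite k S]
  [Algebra.Etale k S] {ι : Type*} [Fintype ι] [DecidableEq ι]

/-- The dual of a basis with respect to the trace form of a finite étale algebra. -/
noncomputable def traceDualBasis (e : Module.Basis ι k S) : Module.Basis ι k S :=
  (Algebra.traceForm k S).dualBasis traceForm_nondegenerate_of_etale e

theorem sum_trace_mul_traceDualBasis_smul (e : Module.Basis ι k S) (a : S) :
    ∑ i, Algebra.trace k S (a * traceDualBasis e i) • e i = a := by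
  conv_rhs => rw [← e.sum_repr a]
  refine Finset.sum_congr rfl fun i _ => ?_
  congr 1
  have h := LinearMap.BilinForm.dualBasis_repr_apply (B := Algebra.traceForm k S)
    traceForm_nondegenerate_of_etale (traceDualBasis e) a i
  rw [traceDualBasis, LinearMap.BilinForm.dualBasis_dualBasis _ (Algebra.traceForm_isSymm k)] at h
  exact h.symm

/-- Pairing with `a` under the trace form turns the sum into the trace of the matrix of
multiplication by `a`. -/
theorem sum_mul_traceDualBasis (e : Module.Basis ι k S) : ∑ i, e i * traceDualBasis e i = 1 := by
  rw [← sub_eq_zero]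
  refine (traceForm_nondegenerate_of_etale (k := k) (S := S)).2 _ fun a => ?_
  rw [Algebra.traceForm_apply, mul_sub, map_sub, sub_eq_zero, mul_one,
    Algebra.trace_eq_matrix_trace e a, Matrix.trace, Finset.mul_sum, map_sum]
  refine Finset.sum_congr rfl fun i _ => ?_
  rw [Matrix.diag_apply, Algebra.leftMulMatrix_eq_repr_mul, ← mul_assoc]
  conv_rhs => rw [← sum_trace_mul_traceDualBasis_smul e (a * e i)]
  simp [Finsupp.single_apply]

/-- The symmetric form `(a, c) ↦ Tr(sa)Tr(c) + Tr(a)Tr(sc) - 2Tr(sac)`. -/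
noncomputable def twistedTraceForm (s : S) : LinearMap.BilinForm k S :=
  LinearMap.mk₂ k (fun a c => Algebra.trace k S (s * a) * Algebra.trace k S c +
      Algebra.trace k S a * Algebra.trace k S (s * c) - 2 * Algebra.trace k S (s * a * c))
    (fun a a' c => by simp only [mul_add, add_mul, map_add]; ring)
    (fun r a c => by simp only [mul_smul_comm, smul_mul_assoc, map_smul, smul_eq_mul]; ring)
    (fun a c c' => by simp only [mul_add, map_add]; ring)
    (fun r a c => by simp only [mul_smul_comm, map_smul, smul_eq_mul]; ring)

theorem twistedTraceForm_apply (s a c : S) : twistedTraceForm (k := k) s a c =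
    Algebra.trace k S (s * a) * Algebra.trace k S c +
      Algebra.trace k S a * Algebra.trace k S (s * c) - 2 * Algebra.trace k S (s * a * c) := rfl

theorem twistedTraceForm_isSymm (s : S) : (twistedTraceForm (k := k) s).IsSymm :=
  ⟨fun a c => by
    simp only [twistedTraceForm_apply, mul_assoc, mul_comm a c]; ring⟩

/-- Expansion in dual bases turns the three terms of the form into `s * 1`, `1 * s` and `-2 * s * ∑
e_i d_i = -2 * s`, which cancel. -/
theorem sum_twistedTraceForm_traceDualBasis (e : Module.Basis ι k S) (s : S) :
    ∑ i, ∑ j, twistedTraceForm (k := k) s (traceDualBasis e i) (traceDualBasis e j) •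
      (e i * e j) = 0 := by
  set d := traceDualBasis e
  have h1 : ∀ t : S, ∑ i, Algebra.trace k S (t * d i) • e i = t :=
    sum_trace_mul_traceDualBasis_smul e
  have h2 : ∑ i, Algebra.trace k S (d i) • e i = 1 := by simpa using h1 1
  have key : ∀ f g : ι → k,
      ∑ i, ∑ j, (f i * g j) • (e i * e j) = (∑ i, f i • e i) * ∑ j, g j • e j := fun f g => by
    rw [Finset.sum_mul_sum]
    simp only [smul_mul_smul_comm]
  have h3 : ∑ i, ∑ j, (2 * Algebra.trace k S (s * d i * d j)) • (e i * e j) = 2 * s := by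
    calc _ = ∑ i, 2 * (e i * ∑ j, Algebra.trace k S (s * d i * d j) • e j) := by
          refine Finset.sum_congr rfl fun i _ => ?_
          rw [Finset.mul_sum, Finset.mul_sum]
          refine Finset.sum_congr rfl fun j _ => ?_
          simp only [Algebra.smul_def, map_mul, map_ofNat]; ring
      _ = 2 * s * ∑ i, e i * d i := by
          rw [Finset.mul_sum]
          refine Finset.sum_congr rfl fun i _ => ?_
          rw [h1]; ring
      _ = 2 * s := by rw [sum_mul_traceDualBasis, mul_one]
  simp only [twistedTraceForm_apply, sub_smul, add_smul, Finset.sum_sub_distrib,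
    Finset.sum_add_distrib, h3, key, h1, h2]
  ring

theorem exists_nondegenerate_twistedTraceForm (h2 : (2 : k) ≠ 0) (hn : 2 ≤ Module.finrank k S) :
    ∃ s : S, (twistedTraceForm (k := k) s).Nondegenerate := by
  have e2 : ∀ c : S, 2 * c = (2 : k) • c := fun c => by rw [Algebra.smul_def, map_ofNat]
  -- Nondegeneracy of the trace form removes the variable `a`: an element `c` of the radical
  -- satisfies `Tr(c)s + Tr(sc) = 2sc`.
  have hred : ∀ s c : S, (∀ a, twistedTraceForm (k := k) s c a = 0) →
      algebraMap k S (Algebra.trace k S c) * s + algebraMap k S (Algebra.trace k S (s * c)) =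
        2 * (s * c) := by
    intro s c h
    rw [← sub_eq_zero]
    refine (traceForm_nondegenerate_of_etale (k := k) (S := S)).1 _ fun a => ?_
    rw [Algebra.traceForm_apply, ← h a, twistedTraceForm_apply]
    have l : ∀ t u : k, (algebraMap k S t * s + algebraMap k S u - 2 * (s * c)) * a =
        t • (s * a) + u • a - (2 : k) • (s * c * a) := fun t u => by
      simp only [Algebra.smul_def, map_ofNat]; ring
    rw [l]
    simp only [map_sub, map_add, map_smul, smul_eq_mul]
    ring
  by_cases h1 : (Module.finrank k S : k) = 1
  · obtain ⟨s, hs, hs0⟩ := exists_isUnit_trace_eq_zero (S := S) h2 hn h1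
    refine ⟨s, (LinearMap.IsRefl.nondegenerate_iff_separatingLeft (B := twistedTraceForm (k := k) s)
      (twistedTraceForm_isSymm s).isRefl).2 fun c hc => ?_⟩
    -- With `n = 1` in `k` and `Tr(s) = 0`, taking traces gives `Tr(sc) = 0`. Cancelling the unit
    -- `s` and taking traces again gives `Tr(c) = 0`.
    have hc := hred s c hc
    have t1 : Algebra.trace k S (s * c) = 0 := by
      have := congrArg (Algebra.trace k S) hc
      rw [map_add, ← Algebra.smul_def, map_smul, hs0, Algebra.trace_algebraMap, e2, map_smul,
        nsmul_eq_mul, h1, smul_eq_mul, smul_eq_mul] at this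
      linear_combination -this
    rw [t1, map_zero, add_zero] at hc
    have hc2 : algebraMap k S (Algebra.trace k S c) = 2 * c :=
      hs.mul_left_cancel (by linear_combination hc)
    have t2 : Algebra.trace k S c = 0 := by
      have := congrArg (Algebra.trace k S) hc2
      rw [Algebra.trace_algebraMap, e2, map_smul, nsmul_eq_mul, h1, smul_eq_mul] at this
      linear_combination -this
    rw [t2, map_zero] at hc2
    rw [e2] at hc2
    exact (smul_eq_zero.1 hc2.symm).resolve_left h2
  · refine ⟨1, (LinearMap.IsRefl.nondegenerate_iff_separatingLeft (B := twistedTraceForm (k := k) (1 : S))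
      (twistedTraceForm_isSymm 1).isRefl).2 fun c hc => ?_⟩
    -- For `s = 1` the relation says `c = Tr(c)`, hence `(n - 1)Tr(c) = 0`.
    have hc := hred 1 c hc
    rw [one_mul, mul_one, ← two_mul] at hc
    have hc : algebraMap k S (Algebra.trace k S c) = c := by
      rw [e2, e2] at hc
      exact smul_right_injective S h2 hc
    have t2 : Algebra.trace k S c = 0 := by
      have := congrArg (Algebra.trace k S) hc
      rw [Algebra.trace_algebraMap, nsmul_eq_mul] at this
      have : ((Module.finrank k S : k) - 1) * Algebra.trace k S c = 0 := by linear_combination this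
      exact (mul_eq_zero.1 this).resolve_left (sub_ne_zero.2 h1)
    rw [← hc, t2, map_zero]

theorem exists_isotropic_isUnit_det_gram (hu : BinaryUniversal k) (h2 : (2 : k) ≠ 0)
    (e : Module.Basis ι k S) {κ : Type*} [Fintype κ] [DecidableEq κ] {B : Matrix κ κ k}
    (hB : B.IsSymm) (hB' : IsUnit B.det) (hι : 2 ≤ Fintype.card ι)
    (hικ : Fintype.card ι < Fintype.card κ) :
    ∃ z : κ → S, pairing B S z z = 0 ∧ IsUnit (gram e B z).det := by
  let _ : Invertible (2 : k) := invertibleOfNonzero h2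
  have hrank : Module.finrank k S = Fintype.card ι := Module.finrank_eq_card_basis e
  obtain ⟨s, hs⟩ := exists_nondegenerate_twistedTraceForm (S := S) h2 (hrank ▸ hι)
  have hBsymm : (Matrix.toBilin' B).IsSymm := ⟨fun x y => by
    have := pairing_symm (S := k) hB x y
    simpa [pairing, Matrix.map_id'] using this⟩
  have hBnd : (Matrix.toBilin' B).Nondegenerate :=
    LinearMap.BilinForm.nondegenerate_toBilin'_of_det_ne_zero' B hB'.ne_zero
  obtain ⟨L, hL⟩ := exists_isometric_embedding hu (Matrix.toBilin' B) hBsymm hBnd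
    (twistedTraceForm s) (twistedTraceForm_isSymm s) hs (by simpa [hrank] using hικ)
  let d := traceDualBasis e
  let z : κ → S := fun a => ∑ i, L (d i) a • e i
  have hz : ∀ a i, e.repr (z a) i = L (d i) a := fun a i => by
    simp [z, Finsupp.single_apply]
  have hg : gram e B z = LinearMap.BilinForm.toMatrix d (twistedTraceForm s) := by
    ext i j
    rw [gram_apply, LinearMap.BilinForm.toMatrix_apply, ← hL, Matrix.toBilin'_apply]
    simp [hz]
  refine ⟨z, ?_, ?_⟩
  · rw [pairing_self_eq_sum_gram e, hg]
    simp only [LinearMap.BilinForm.toMatrix_apply]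
    exact sum_twistedTraceForm_traceDualBasis e s
  · rw [hg]
    exact ((LinearMap.BilinForm.nondegenerate_iff_det_ne_zero d).1 hs).isUnit

end EtaleForm

end QuadSpace

namespace QuadSpace

/-! ### Making a pairing invertible over a semi-local ring -/

section Approximation

theorem exists_forall_mk_eq {S : Type*} [CommRing S] [Finite (MaximalSpectrum S)]
    (y : ∀ M : MaximalSpectrum S, S ⧸ M.asIdeal) :
    ∃ r : S, ∀ M : MaximalSpectrum S, Ideal.Quotient.mk M.asIdeal r = y M :=
  Ideal.pi_quotient_surjective
    (fun _ _ ne => Ideal.isCoprime_of_isMaximal (MaximalSpectrum.ext_iff.ne.mp ne)) y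

theorem isUnit_of_forall_mk_ne_zero {S : Type*} [CommRing S] {r : S}
    (h : ∀ M : MaximalSpectrum S, Ideal.Quotient.mk M.asIdeal r ≠ 0) : IsUnit r := by
  by_contra hr
  obtain ⟨M, hM, hrM⟩ := exists_max_ideal_of_mem_nonunits hr
  exact h ⟨M, hM⟩ (Ideal.Quotient.eq_zero_iff_mem.2 hrM)

variable {κ : Type*} [Fintype κ] [DecidableEq κ]

/-- Suppose the expression vanishes for all `y`. If `b(x,z) = 0`, a product of two nonzero linear
forms would vanish identically. Otherwise polarizing in `y` shows that `x` and `z` span the space,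
which has dimension at least 3. -/
theorem exists_pairing_ne_zero_of_field {K : Type*} [Field K] (h2 : (2 : K) ≠ 0) {B : Matrix κ κ K}
    (hB : B.IsSymm) (hB' : IsUnit B.det) (hκ : 3 ≤ Fintype.card κ) {x z : κ → K} (hx : x ≠ 0)
    (hz : z ≠ 0) : ∃ y : κ → K,
      pairing B K y y * pairing B K x z - 2 * pairing B K x y * pairing B K y z ≠ 0 := by
  have hnd : (pairing B K).Nondegenerate := by
    have := LinearMap.BilinForm.nondegenerate_toBilin'_of_det_ne_zero' B hB'.ne_zero
    simpa [pairing, Matrix.map_id'] using this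
  by_contra! h
  by_cases hc : pairing B K x z = 0
  · obtain ⟨y₁, hy₁⟩ : ∃ y, pairing B K x y ≠ 0 := by
      by_contra! h'
      exact hx (hnd.1 x h')
    obtain ⟨y₂, hy₂⟩ : ∃ y, pairing B K y z ≠ 0 := by
      by_contra! h'
      exact hz (hnd.2 z h')
    have h' : ∀ y, pairing B K x y * pairing B K y z = 0 := fun y => by
      have := h y
      rw [hc, mul_zero, zero_sub, neg_eq_zero, mul_assoc] at this
      exact (mul_eq_zero.1 this).resolve_left h2
    have h₁ := (mul_eq_zero.1 (h' y₁)).resolve_left hy₁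
    have h₂ := (mul_eq_zero.1 (h' y₂)).resolve_right hy₂
    have h₃ := h' (y₁ + y₂)
    simp only [map_add, LinearMap.add_apply, h₁, h₂, add_zero, zero_add] at h₃
    exact mul_ne_zero hy₁ hy₂ h₃
  · have key : ∀ y, pairing B K x z • y = pairing B K x y • z + pairing B K y z • x := fun y => by
      rw [← sub_eq_zero]
      refine hnd.1 _ fun y' => ?_
      have h₁ := h y
      have h₂ := h y'
      have h₃ := h (y + y')
      simp only [map_add, LinearMap.add_apply] at h₃
      rw [pairing_symm hB y' y] at h₃
      simp only [map_sub, map_add, map_smul, LinearMap.sub_apply, LinearMap.add_apply,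
        LinearMap.smul_apply, smul_eq_mul]
      rw [pairing_symm hB z y']
      apply mul_left_cancel₀ h2
      linear_combination h₃ - h₁ - h₂
    have htop : Submodule.span K (Set.range ![x, z]) = ⊤ := by
      rw [eq_top_iff]
      intro y _
      have : y = (pairing B K x z)⁻¹ • (pairing B K x y • z + pairing B K y z • x) := by
        rw [← key, smul_smul, inv_mul_cancel₀ hc, one_smul]
      rw [this]
      exact Submodule.smul_mem _ _ (add_mem
        (Submodule.smul_mem _ _ (Submodule.subset_span ⟨1, rfl⟩))
        (Submodule.smul_mem _ _ (Submodule.subset_span ⟨0, rfl⟩)))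
    have := finrank_range_le_card (R := K) (b := ![x, z])
    rw [Set.finrank, htop, finrank_top, Module.finrank_fintype_fun_eq_card, Fintype.card_fin] at this
    omega

theorem exists_isUnit_pairing_refl {S : Type*} [CommRing S] [Finite (MaximalSpectrum S)]
    (h2 : IsUnit (2 : S)) {B : Matrix κ κ S} (hB : B.IsSymm) (hB' : IsUnit B.det)
    (hκ : 3 ≤ Fintype.card κ) {x z : κ → S} (hx : ∃ φ : κ → S, φ ⬝ᵥ x = 1)
    (hz : ∃ φ : κ → S, φ ⬝ᵥ z = 1) : ∃ y : κ → S, IsUnit (pairing B S (refl B x y) z) := by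
  let _ : ∀ M : MaximalSpectrum S, Field (S ⧸ M.asIdeal) := fun M => Ideal.Quotient.field _
  let π : ∀ M : MaximalSpectrum S, S →+* S ⧸ M.asIdeal := fun M => Ideal.Quotient.mk M.asIdeal
  have hne : ∀ (M : MaximalSpectrum S) (w : κ → S), (∃ φ : κ → S, φ ⬝ᵥ w = 1) →
      (fun a => π M (w a)) ≠ 0 := by
    rintro M w ⟨φ, hφ⟩ h0
    have : π M (φ ⬝ᵥ w) = 0 := by
      rw [dotProduct, map_sum]
      exact Finset.sum_eq_zero fun a _ => by rw [map_mul, congrFun h0 a, Pi.zero_apply, mul_zero]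
    rw [hφ, map_one] at this
    exact one_ne_zero this
  have hloc : ∀ M : MaximalSpectrum S, ∃ y : κ → S ⧸ M.asIdeal,
      pairing (B.map (π M)) _ (refl (B.map (π M)) (fun a => π M (x a)) y) (fun a => π M (z a)) ≠ 0 :=
      fun M => by
    simp only [pairing_refl]
    refine exists_pairing_ne_zero_of_field ?_ (hB.map _) ?_ hκ (hne M x hx) (hne M z hz)
    · have := h2.map (π M)
      rw [map_ofNat] at this
      exact this.ne_zero
    · have := hB'.map (π M)
      rwa [RingHom.map_det] at this
  choose y hy using hloc
  choose w hw using fun a => exists_forall_mk_eq fun M => y M a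
  refine ⟨w, isUnit_of_forall_mk_ne_zero fun M => ?_⟩
  have hyw : y M = fun a => π M (w a) := funext fun a => (hw a M).symm
  have := hy M
  rw [hyw, refl_map (π M) (π M) (fun _ => rfl), pairing_map (π M) (π M) (fun _ => rfl)] at this
  exact this

end Approximation

/-! ### The Gram determinant over a field -/

section FieldCase

open scoped TensorProduct

variable {k S : Type*} [Field k] [CommRing S] [Algebra k S] {ι κ : Type*} [Fintype ι]
  [DecidableEq ι] [Fintype κ] [DecidableEq κ]

theorem exists_det_gram_refl_ne_zero_of_binaryUniversal [Module.Finite k S] [Algebra.Etale k S]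
    (hu : BinaryUniversal k) (h2 : (2 : k) ≠ 0)
    (e : Module.Basis ι k S) {B : Matrix κ κ k}
    (hB : B.IsSymm) (hB' : IsUnit B.det) (hι : 2 ≤ Fintype.card ι)
    (hικ : Fintype.card ι < Fintype.card κ) {x : κ → S} (hx : ∃ φ : κ → S, φ ⬝ᵥ x = 1) :
    ∃ y z : κ → S, (gram e B (refl B (refl B x y) z)).det ≠ 0 := by
  -- Hence `S` has finitely many maximal ideals, and the approximation argument applies over `S`
  -- itself.
  have : IsArtinianRing S := isArtinian_of_tower k inferInstance
  obtain ⟨z, hz, hzg⟩ := exists_isotropic_isUnit_det_gram hu h2 e hB hB' hι hικ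
  have h2S : IsUnit (2 : S) := by
    have := h2.isUnit.map (algebraMap k S)
    rwa [map_ofNat] at this
  have hB'S : IsUnit (B.map (algebraMap k S)).det := by
    have := hB'.map (algebraMap k S)
    rwa [RingHom.map_det] at this
  obtain ⟨y, hy⟩ := exists_isUnit_pairing_refl h2S (hB.map (algebraMap k S)) hB'S (by omega) hx
    (exists_dotProduct_eq_one_of_isUnit_det_gram e B z hzg)
  have hpair : pairing (B.map (algebraMap k S)) S = pairing B S := by
    simp [pairing]
  rw [refl, hpair, ← refl] at hy
  refine ⟨y, z, ?_⟩
  rw [refl_of_pairing_self_eq_zero _ hz]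
  exact (isUnit_det_gram_smul e B z (h2S.mul hy).neg hzg).ne_zero

/-- The determinant, for generic `y` and `z`, of the Gram matrix of the double reflection of `x`
along `y` and `z`. -/
noncomputable def genericDet (e : Module.Basis ι k S) (B : Matrix κ κ k) (x : κ → S) :
    MvPolynomial (κ × ι ⊕ κ × ι) k :=
  let A := MvPolynomial (κ × ι ⊕ κ × ι) k
  let e' := e.baseChange A
  let B' := B.map (algebraMap k A)
  (gram e' B' (refl B' (refl B' (fun a => (1 : A) ⊗ₜ[k] x a)
    fun a => ∑ i, (MvPolynomial.X (Sum.inl (a, i)) : A) • e' i)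
    fun a => ∑ i, (MvPolynomial.X (Sum.inr (a, i)) : A) • e' i)).det

theorem aeval_genericDet (e : Module.Basis ι k S) (B : Matrix κ κ k) (x : κ → S)
    {A : Type*} [CommRing A] [Algebra k A] (y z : κ → A ⊗[k] S) (p : κ × ι ⊕ κ × ι → A)
    (hpy : ∀ s, p (Sum.inl s) = (e.baseChange A).repr (y s.1) s.2)
    (hpz : ∀ s, p (Sum.inr s) = (e.baseChange A).repr (z s.1) s.2) :
    MvPolynomial.aeval p (genericDet e B x) =
    (gram (e.baseChange A) (B.map (algebraMap k A)) (refl (B.map (algebraMap k A))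
      (refl (B.map (algebraMap k A)) (fun a => (1 : A) ⊗ₜ[k] x a) y) z)).det := by
  set f := MvPolynomial.aeval (R := k) p with hf
  let ψ := Algebra.TensorProduct.map f (AlgHom.id k S)
  have h : ∀ r, ψ (algebraMap (MvPolynomial (κ × ι ⊕ κ × ι) k) _ r) =
      algebraMap A (A ⊗[k] S) (f r) := fun r => by
    simp [ψ, Algebra.TensorProduct.algebraMap_apply]
  have he : ∀ i, ψ (e.baseChange _ i) = e.baseChange A i := fun i => by
    simp [ψ]
  have hm := det_gram_map (f : MvPolynomial (κ × ι ⊕ κ × ι) k →+* A) (ψ : _ →+* A ⊗[k] S) h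
    (e.baseChange _) (e.baseChange A) he (B.map (algebraMap k _))
    (fun a => (1 : MvPolynomial (κ × ι ⊕ κ × ι) k) ⊗ₜ[k] x a)
    (fun a => ∑ i, (MvPolynomial.X (Sum.inl (a, i)) : MvPolynomial (κ × ι ⊕ κ × ι) k) •
      e.baseChange _ i)
    (fun a => ∑ i, (MvPolynomial.X (Sum.inr (a, i)) : MvPolynomial (κ × ι ⊕ κ × ι) k) •
      e.baseChange _ i)
  have hB : (B.map (algebraMap k (MvPolynomial (κ × ι ⊕ κ × ι) k))).map f =
      B.map (algebraMap k A) := by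
    ext a b
    exact f.commutes _
  have hx : (fun a => ψ ((1 : MvPolynomial (κ × ι ⊕ κ × ι) k) ⊗ₜ[k] x a)) =
      fun a => (1 : A) ⊗ₜ[k] x a := by
    funext a; simp [ψ]
  have hlin : ∀ (t : κ → A ⊗[k] S) (v : κ × ι → κ × ι ⊕ κ × ι),
      (∀ p, f (MvPolynomial.X (v p)) = (e.baseChange A).repr (t p.1) p.2) →
      (fun a => ψ (∑ i, (MvPolynomial.X (v (a, i)) : MvPolynomial (κ × ι ⊕ κ × ι) k) •
        e.baseChange _ i)) = t := by
    intro t v hv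
    funext a
    rw [← (e.baseChange A).sum_repr (t a), map_sum]
    refine Finset.sum_congr rfl fun i _ => ?_
    rw [Algebra.smul_def, map_mul, h, he, hv, ← Algebra.smul_def]
  have hy := hlin y Sum.inl fun s => by rw [hf, MvPolynomial.aeval_X, hpy]
  have hz := hlin z Sum.inr fun s => by rw [hf, MvPolynomial.aeval_X, hpz]
  simp only [RingHom.coe_coe] at hm
  rw [hB, hx, hy, hz] at hm
  exact hm.symm

/-- Over an infinite field, a nonzero value over the algebraic closure shows that the generic
determinant is a nonzero polynomial, so it is also nonzero at some `k`-rational point. -/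
theorem exists_det_gram_refl_ne_zero [Module.Finite k S] [Algebra.Etale k S] (h2 : (2 : k) ≠ 0)
    (e : Module.Basis ι k S) {B : Matrix κ κ k}
    (hB : B.IsSymm) (hB' : IsUnit B.det) (hι : 2 ≤ Fintype.card ι)
    (hικ : Fintype.card ι < Fintype.card κ) {x : κ → S} (hx : ∃ φ : κ → S, φ ⬝ᵥ x = 1) :
    ∃ y z : κ → S, (gram e B (refl B (refl B x y) z)).det ≠ 0 := by
  cases finite_or_infinite k
  · exact exists_det_gram_refl_ne_zero_of_binaryUniversal (binaryUniversal_of_finite h2) h2 e hB hB'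
      hι hικ hx
  · let K := AlgebraicClosure k
    have hne : genericDet e B x ≠ 0 := by
      intro h0
      obtain ⟨φ, hφ⟩ := hx
      obtain ⟨y, z, hyz⟩ := exists_det_gram_refl_ne_zero_of_binaryUniversal
        (binaryUniversal_of_isAlgClosed (k := K)) (by
          have := h2.isUnit.map (algebraMap k K)
          rw [map_ofNat] at this
          exact this.ne_zero)
        (e.baseChange K) (hB.map (algebraMap k K))
        (by have := hB'.map (algebraMap k K); rwa [RingHom.map_det] at this) hι hικ
        (x := fun a => (1 : K) ⊗ₜ[k] x a)
        ⟨fun a => (1 : K) ⊗ₜ[k] φ a, by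
          have := congrArg (Algebra.TensorProduct.includeRight : S →ₐ[k] K ⊗[k] S) hφ
          simpa [dotProduct, map_sum, Algebra.TensorProduct.one_def] using this⟩
      apply hyz
      rw [← aeval_genericDet (p := Sum.elim (fun s => (e.baseChange K).repr (y s.1) s.2)
        fun s => (e.baseChange K).repr (z s.1) s.2) (hpy := fun _ => rfl) (hpz := fun _ => rfl),
        h0, map_zero]
    obtain ⟨p, hp⟩ : ∃ p, MvPolynomial.aeval p (genericDet e B x) ≠ (0 : k) := by
      by_contra! h
      refine hne (MvPolynomial.funext fun p => ?_)
      rw [map_zero, ← h p, MvPolynomial.aeval_eq_eval]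
    let lin : (κ × ι → k) → κ → k ⊗[k] S := fun q a => ∑ i, q (a, i) • e.baseChange k i
    have hlin : ∀ (q : κ × ι → k) s, q s = (e.baseChange k).repr (lin q s.1) s.2 := fun q s => by
      simp [lin, Finsupp.single_apply, -Module.Basis.baseChange_apply]
    have := aeval_genericDet e B x (lin fun s => p (Sum.inl s)) (lin fun s => p (Sum.inr s)) p
      (hlin _) (hlin _)
    rw [this] at hp
    let ψ := Algebra.TensorProduct.lid k S
    have hm := det_gram_map (RingHom.id k) (ψ : k ⊗[k] S →+* S) (fun r => by simp [ψ, Algebra.algebraMap_eq_smul_one])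
      (e.baseChange k) e (fun i => by simp [ψ]) (B.map (algebraMap k k))
      (fun a => (1 : k) ⊗ₜ[k] x a) (lin fun s => p (Sum.inl s)) (lin fun s => p (Sum.inr s))
    have hBB : (B.map (algebraMap k k)).map (RingHom.id k) = B := by ext; rfl
    have hxx : (fun a => (ψ : k ⊗[k] S →+* S) ((1 : k) ⊗ₜ[k] x a)) = x := by
      funext a; simp [ψ]
    rw [hBB, hxx] at hm
    exact ⟨_, _, by rw [hm]; exact hp⟩

end FieldCase

end QuadSpace

namespace QuadSpace

open scoped TensorProduct

/-! ### From residue fields to the semi-local base -/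

section Semilocal

variable {R S : Type*} [CommRing R] [CommRing S] [Algebra R S] {ι κ : Type*} [Fintype ι]
  [DecidableEq ι] [Fintype κ] [DecidableEq κ]

theorem exists_pairing_self_eq_zero_isUnit_det_gram [Finite (MaximalSpectrum R)]
    (h2 : IsUnit (2 : R)) [Module.Finite R S] [Algebra.Etale R S] (e : Module.Basis ι R S)
    {B : Matrix κ κ R} (hB : B.IsSymm) (hB' : IsUnit B.det) (hι : 2 ≤ Fintype.card ι)
    (hικ : Fintype.card ι < Fintype.card κ) {x : κ → S} (hx : ∃ φ : κ → S, φ ⬝ᵥ x = 1)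
    (hxx : pairing B S x x = 0) :
    ∃ w : κ → S, pairing B S w w = 0 ∧ IsUnit (gram e B w).det := by
  let _ : ∀ M : MaximalSpectrum R, Field (R ⧸ M.asIdeal) := fun M => Ideal.Quotient.field _
  let π : ∀ M : MaximalSpectrum R, R →+* R ⧸ M.asIdeal := fun M => Ideal.Quotient.mk M.asIdeal
  let ψ : ∀ M : MaximalSpectrum R, S →ₐ[R] (R ⧸ M.asIdeal) ⊗[R] S := fun M =>
    Algebra.TensorProduct.includeRight
  have hψ : ∀ (M : MaximalSpectrum R) (r : R), (ψ M : S →+* (R ⧸ M.asIdeal) ⊗[R] S)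
      (algebraMap R S r) = algebraMap (R ⧸ M.asIdeal) ((R ⧸ M.asIdeal) ⊗[R] S) (π M r) :=
    fun M r => (ψ M).commutes r
  have he : ∀ (M : MaximalSpectrum R) (i : ι), (ψ M : S →+* (R ⧸ M.asIdeal) ⊗[R] S) (e i) = e.baseChange (R ⧸ M.asIdeal) i := fun M i => by
    simp [ψ]
  have hloc : ∀ M : MaximalSpectrum R, ∃ y z : κ → (R ⧸ M.asIdeal) ⊗[R] S,
      (gram (e.baseChange (R ⧸ M.asIdeal)) (B.map (π M)) (refl (B.map (π M)) (refl (B.map (π M))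
        (fun a => (ψ M : S →+* _) (x a)) y) z)).det ≠ 0 := fun M => by
    refine exists_det_gram_refl_ne_zero ?_ _ (hB.map _) ?_ hι hικ ?_
    · have := h2.map (π M)
      rw [map_ofNat] at this
      exact this.ne_zero
    · have := hB'.map (π M)
      rwa [RingHom.map_det] at this
    · obtain ⟨φ, hφ⟩ := hx
      refine ⟨fun a => ψ M (φ a), ?_⟩
      have := congrArg (ψ M) hφ
      simpa only [dotProduct, map_sum, map_mul, map_one, RingHom.coe_coe] using this
  choose y z hyz using hloc
  -- Chinese remainder theorem, applied to the coordinates in the basis `e`.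
  have hlift : ∀ t : ∀ M : MaximalSpectrum R, κ → (R ⧸ M.asIdeal) ⊗[R] S,
      ∃ t' : κ → S, ∀ M, (fun a => (ψ M : S →+* _) (t' a)) = t M := by
    intro t
    choose c hc using fun a i => exists_forall_mk_eq fun M =>
      (e.baseChange (R ⧸ M.asIdeal)).repr (t M a) i
    refine ⟨fun a => ∑ i, c a i • e i, fun M => funext fun a => ?_⟩
    rw [← (e.baseChange (R ⧸ M.asIdeal)).sum_repr (t M a), map_sum]
    refine Finset.sum_congr rfl fun i _ => ?_
    rw [Algebra.smul_def, map_mul, hψ, he, ← Algebra.smul_def]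
    congr 1
    exact hc a i M
  obtain ⟨y', hy'⟩ := hlift y
  obtain ⟨z', hz'⟩ := hlift z
  refine ⟨refl B (refl B x y') z', pairing_refl_self hB (pairing_refl_self hB hxx _) _,
    isUnit_of_forall_mk_ne_zero fun M => ?_⟩
  have := hyz M
  rw [← hy', ← hz', det_gram_map (π M) _ (hψ M) e _ (he M)] at this
  exact this

theorem nonempty_basis_of_rankAtStalk_eq [Finite (MaximalSpectrum R)] {M : Type*} [AddCommGroup M]
    [Module R M] [Module.Finite R M] [Module.Flat R M] (n : ℕ)
    (h : ∀ p : PrimeSpectrum R, Module.rankAtStalk M p = n) :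
    Nonempty (Module.Basis (Fin n) R M) := by
  refine Module.nonempty_basis_of_flat_of_finrank_eq R M n fun P => ?_
  let _ : Field (R ⧸ P.asIdeal) := Ideal.Quotient.field _
  rw [← h (PrimeSpectrum.comap (algebraMap R (R ⧸ P.asIdeal)) ⊥), ← Module.rankAtStalk_baseChange,
    Module.rankAtStalk_eq_finrank_of_free]
  rfl

end Semilocal

/-! ### Translation between quadratic spaces and matrices -/

section Coordinates

variable {R S V : Type*} [CommRing R] [CommRing S] [Algebra R S] [AddCommGroup V] [Module R V]
  {ι κ : Type*} [Fintype ι] [DecidableEq ι] [Fintype κ] [DecidableEq κ]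

theorem bijective_iff_isUnit_det_toMatrix (b : Module.Basis ι R V) (f : LinearMap.BilinForm R V) :
    Function.Bijective (f : V → Module.Dual R V) ↔
      IsUnit (LinearMap.BilinForm.toMatrix b f).det := by
  have h : LinearMap.toMatrix b b.dualBasis f = (LinearMap.BilinForm.toMatrix b f).transpose := by
    ext i j
    simp [LinearMap.toMatrix_apply, LinearMap.BilinForm.toMatrix_apply]
  rw [← Matrix.det_transpose, ← h]
  constructor
  · intro hf
    exact LinearEquiv.isUnit_det (LinearEquiv.ofBijective f hf) b b.dualBasis
  · intro hf
    exact (LinearEquiv.ofIsUnitDet hf).bijective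

/-- The Gram matrix of a finite family of vectors for the polar form of `q`. -/
def polarMatrix (q : QuadraticForm R V) (v : ι → V) : Matrix ι ι R :=
  Matrix.of fun i j => QuadraticMap.polar q (v i) (v j)

theorem polarMatrix_isSymm (q : QuadraticForm R V) (v : ι → V) : (polarMatrix q v).IsSymm := by
  ext i j
  exact QuadraticMap.polar_comm q _ _

theorem two_mul_baseChange_sum_tmul [Invertible (2 : R)] (q : QuadraticForm R V) (x : κ → S)
    (v : κ → V) : 2 * QuadraticForm.baseChange S q (∑ a, x a ⊗ₜ[R] v a) =
      pairing (polarMatrix q v) S x x := by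
  let _ : Invertible (2 : S) := (Invertible.map (algebraMap R S) 2).copy 2 (map_ofNat _ 2).symm
  have h : QuadraticMap.polarBilin (QuadraticForm.baseChange S q) (∑ a, x a ⊗ₜ[R] v a)
      (∑ a, x a ⊗ₜ[R] v a) = 2 * QuadraticForm.baseChange S q (∑ a, x a ⊗ₜ[R] v a) := by
    rw [QuadraticMap.polarBilin_apply_apply, QuadraticMap.polar_self, two_nsmul, two_mul]
  rw [← h, QuadraticForm.polarBilin_baseChange, pairing_apply]
  simp only [map_sum, LinearMap.sum_apply]
  rw [Finset.sum_comm]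
  refine Finset.sum_congr rfl fun a _ => Finset.sum_congr rfl fun b _ => ?_
  rw [LinearMap.BilinForm.baseChange_tmul, QuadraticMap.polarBilin_apply_apply, Algebra.smul_def]
  simp only [polarMatrix, Matrix.of_apply]
  rw [QuadraticMap.polar_comm]
  ring

theorem isUnit_det_polarMatrix (q : QuadraticForm R V) (hq : IsQuadraticSpace q)
    (b : Module.Basis ι R V) : IsUnit (polarMatrix q b).det := by
  have h : LinearMap.BilinForm.toMatrix b (QuadraticMap.polarBilin q) = polarMatrix q b := by
    ext i j
    rw [LinearMap.BilinForm.toMatrix_apply]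
    rfl
  rw [← h]
  exact (bijective_iff_isUnit_det_toMatrix b _).1 hq.nondegenerate

theorem linearIndependent_of_isUnit_det_polarMatrix (q : QuadraticForm R V) {v : ι → V}
    (hv : IsUnit (polarMatrix q v).det) : LinearIndependent R v := by
  rw [Fintype.linearIndependent_iff]
  intro g hg
  have : (polarMatrix q v).mulVec g = 0 := by
    funext i
    have h := congrArg (QuadraticMap.polarBilin q (v i)) hg
    simp only [map_sum, map_smul, map_zero, QuadraticMap.polarBilin_apply_apply, smul_eq_mul] at h
    rw [Pi.zero_apply, ← h]
    exact Finset.sum_congr rfl fun j _ => mul_comm _ _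
  have hg0 : g = 0 := by
    rw [← Matrix.one_mulVec g, ← Matrix.nonsing_inv_mul _ hv, ← Matrix.mulVec_mulVec, this,
      Matrix.mulVec_zero]
  exact congrFun hg0

theorem isSubspaceOfRank_span_of_isUnit_det_polarMatrix [Nontrivial R] (q : QuadraticForm R V)
    {v : ι → V} (hv : IsUnit (polarMatrix q v).det) :
    IsSubspaceOfRank q (Submodule.span R (Set.range v)) (Fintype.card ι) := by
  let b := Module.Basis.span (linearIndependent_of_isUnit_det_polarMatrix q hv)
  refine ⟨⟨.of_basis b, .of_basis b, ?_⟩, Module.finrank_eq_card_basis b⟩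
  rw [bijective_iff_isUnit_det_toMatrix b]
  convert hv using 2
  ext i j
  rw [LinearMap.BilinForm.toMatrix_apply, QuadraticMap.polarBilin_apply_apply]
  have hb : ∀ i, (b i : V) = v i := fun i => congrArg Subtype.val (Module.Basis.span_apply _ i)
  simp only [polarMatrix, Matrix.of_apply, ← hb]
  rfl

/-- Invertibility of the Gram matrix gives a functional on `V` sending `v i` to the `i`-th
coordinate of 1; its scalar extension sends the vector to 1. -/
theorem isUnimodular_sum_tmul (e : Module.Basis ι R S) (q : QuadraticForm R V) {v : ι → V}
    (hv : IsUnit (polarMatrix q v).det) : IsUnimodular S (∑ i, e i ⊗ₜ[R] v i) := by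
  let d : ι → R := ((polarMatrix q v)⁻¹).mulVec fun i => e.repr 1 i
  let f : Module.Dual R V := QuadraticMap.polarBilin q (∑ j, d j • v j)
  have hf : ∀ i, f (v i) = e.repr 1 i := fun i => by
    have h : (polarMatrix q v).mulVec d = fun i => e.repr 1 i := by
      rw [Matrix.mulVec_mulVec, Matrix.mul_nonsing_inv _ hv, Matrix.one_mulVec]
    rw [← congrFun h i]
    simp only [f, map_sum, map_smul, LinearMap.sum_apply, LinearMap.smul_apply,
      QuadraticMap.polarBilin_apply_apply, smul_eq_mul]
    refine Finset.sum_congr rfl fun j _ => ?_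
    rw [mul_comm, QuadraticMap.polar_comm]
    rfl
  refine ⟨f.baseChange S, ?_⟩
  simp only [map_sum, Module.Dual.baseChange_apply_tmul, hf]
  exact e.sum_repr 1

theorem isIsotropicVector_sum_tmul [Invertible (2 : R)] (e : Module.Basis ι R S)
    (q : QuadraticForm R V) {v : ι → V} (hv : IsUnit (polarMatrix q v).det)
    (h0 : pairing (polarMatrix q v) S e e = 0) :
    IsIsotropicVector (QuadraticForm.baseChange S q) (∑ i, e i ⊗ₜ[R] v i) := by
  refine ⟨isUnimodular_sum_tmul e q hv, ?_⟩
  have h2 : IsUnit (2 : S) := by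
    have := (isUnit_of_invertible (2 : R)).map (algebraMap R S)
    rwa [map_ofNat] at this
  rw [← h2.mul_right_eq_zero, two_mul_baseChange_sum_tmul, h0]

theorem polarMatrix_sum_repr_smul (e : Module.Basis ι R S) (q : QuadraticForm R V) (u : κ → V)
    (w : κ → S) :
    polarMatrix q (fun i => ∑ a, e.repr (w a) i • u a) = gram e (polarMatrix q u) w := by
  ext i j
  rw [gram_apply, polarMatrix, Matrix.of_apply, ← QuadraticMap.polarBilin_apply_apply]
  simp only [map_sum, map_smul, LinearMap.sum_apply, LinearMap.smul_apply, smul_eq_mul,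
    QuadraticMap.polarBilin_apply_apply, Finset.mul_sum]
  rw [Finset.sum_comm]
  refine Finset.sum_congr rfl fun a _ => Finset.sum_congr rfl fun c _ => ?_
  simp only [polarMatrix, Matrix.of_apply]
  ring

theorem pairing_gram_basis (e : Module.Basis ι R S) (B : Matrix κ κ R) (w : κ → S) :
    pairing (gram e B w) S e e = pairing B S w w := by
  rw [pairing_self_eq_sum_gram e B w, pairing_apply]
  refine Finset.sum_congr rfl fun i _ => Finset.sum_congr rfl fun j _ => ?_
  rw [Algebra.smul_def]; ring

theorem exists_isotropic_coordinates [Invertible (2 : R)] (b : Module.Basis κ R V)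
    (q : QuadraticForm R V) (hiso : IsIsotropic (QuadraticForm.baseChange S q)) :
    ∃ x : κ → S, (∃ φ : κ → S, φ ⬝ᵥ x = 1) ∧ pairing (polarMatrix q b) S x x = 0 := by
  obtain ⟨X, ⟨φ, hφ⟩, hX⟩ := hiso
  obtain ⟨x, rfl⟩ : ∃ x : κ → S, X = ∑ a, x a ⊗ₜ[R] b a := by
    refine ⟨fun a => (b.baseChange S).repr X a, ?_⟩
    conv_lhs => rw [← (b.baseChange S).sum_repr X]
    refine Finset.sum_congr rfl fun a _ => ?_
    rw [Module.Basis.baseChange_apply, TensorProduct.smul_tmul', smul_eq_mul, mul_one]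
  refine ⟨x, ⟨fun a => φ (1 ⊗ₜ b a), ?_⟩, ?_⟩
  · refine Eq.trans ?_ hφ
    rw [map_sum]
    refine Finset.sum_congr rfl fun a _ => ?_
    have : x a ⊗ₜ[R] b a = x a • ((1 : S) ⊗ₜ[R] b a) := by
      rw [TensorProduct.smul_tmul', smul_eq_mul, mul_one]
    rw [this, map_smul, smul_eq_mul, mul_comm]
  · rw [← two_mul_baseChange_sum_tmul, hX, mul_zero]

theorem exists_isotropic_subspace [Nontrivial R] [Finite (MaximalSpectrum R)] [Invertible (2 : R)]
    [Module.Finite R S] [Algebra.Etale R S] (e : Module.Basis ι R S) (hι : 2 ≤ Fintype.card ι)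
    (q : QuadraticForm R V) (hq : IsQuadraticSpace q) (hV : Fintype.card ι < Module.finrank R V)
    (hiso : IsIsotropic (QuadraticForm.baseChange S q)) :
    ∃ v : ι → V, IsIsotropicVector (QuadraticForm.baseChange S q) (∑ i, e i ⊗ₜ[R] v i) ∧
      IsSubspaceOfRank q (Submodule.span R (Set.range v)) (Fintype.card ι) ∧
      IsIsotropic (QuadraticForm.baseChange S
        (q.restrict (Submodule.span R (Set.range v)))) := by
  have := hq.free
  have := hq.finite
  let b := Module.finBasis R V
  have hB := isUnit_det_polarMatrix q hq b
  obtain ⟨x, hx, hxx⟩ := exists_isotropic_coordinates b q hiso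
  obtain ⟨w, hw, hwg⟩ := exists_pairing_self_eq_zero_isUnit_det_gram (isUnit_of_invertible (2 : R))
    e (polarMatrix_isSymm q b) hB hι (by simpa using hV) hx hxx
  obtain ⟨v, hg⟩ : ∃ v : ι → V, polarMatrix q v = gram e (polarMatrix q b) w :=
    ⟨_, polarMatrix_sum_repr_smul e q b w⟩
  rw [← hg] at hwg
  rw [← pairing_gram_basis e, ← hg] at hw
  -- The same vectors viewed inside their span have the same Gram matrix, so the isotropic vector
  -- already lives in the scalar extension of the span.
  let v' : ι → Submodule.span R (Set.range v) := fun i => ⟨v i, Submodule.subset_span ⟨i, rfl⟩⟩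
  have hv' : polarMatrix (q.restrict (Submodule.span R (Set.range v))) v' = polarMatrix q v := rfl
  have hw' : pairing (polarMatrix (q.restrict (Submodule.span R (Set.range v))) v') S e e = 0 := by
    rw [hv', hw]
  refine ⟨v, isIsotropicVector_sum_tmul e q hwg hw,
    isSubspaceOfRank_span_of_isUnit_det_polarMatrix q hwg, ∑ i, e i ⊗ₜ[R] v' i, ?_⟩
  exact isIsotropicVector_sum_tmul e _ (by rw [hv']; exact hwg) hw'

end Coordinates

/-! ### Power bases for polynomials with invertible leading coefficient -/

section PowerBasis

open Polynomial

theorem exists_basis_eq_root_pow {R : Type*} [CommRing R] (f : R[X])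
    (hf : IsUnit f.leadingCoeff) :
    ∃ b : Module.Basis (Fin f.natDegree) R (AdjoinRoot f), ∀ i, b i = AdjoinRoot.root f ^ (i : ℕ) := by
  obtain ⟨u, hu⟩ := hf
  let c : R := ↑u⁻¹
  have hc : f.leadingCoeff * c = 1 := by rw [← hu]; exact u.mul_inv
  have hg : (f * C c).Monic := monic_mul_C_of_leadingCoeff_mul_eq_one hc
  have hfg : Associated f (f * C c) := ⟨u⁻¹.map C.toMonoidHom, rfl⟩
  have hdeg : (f * C c).natDegree = f.natDegree :=
    natDegree_mul_C_eq_of_mul_eq_one (show c * ↑u = 1 from u.inv_mul)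
  let φ := AdjoinRoot.algEquivOfAssociated R (f * C c) f hfg.symm
  refine ⟨((AdjoinRoot.powerBasis' hg).basis.map φ.toLinearEquiv).reindex (finCongr hdeg),
    fun i => ?_⟩
  simp [φ]
  rfl

end PowerBasis

end QuadSpace

/-! ### The main theorem -/

theorem proposition3p1 {R S V : Type*} [CommRing R] [Finite (MaximalSpectrum R)]
    [Invertible (2 : R)]
    [CommRing S] [Algebra R S] [Module.Finite R S] [Algebra.Etale R S]
    (n : ℕ) (hn : 2 ≤ n) (hS : ∀ p : PrimeSpectrum R, Module.rankAtStalk S p = n)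
    [AddCommGroup V] [Module R V] (q : QuadraticForm R V)
    (hq : QuadSpace.IsQuadraticSpace q) (hV : n < Module.finrank R V)
    (hiso : QuadSpace.IsIsotropic (QuadraticForm.baseChange S q)) :
    (∃ W : Submodule R V, QuadSpace.IsSubspaceOfRank q W n ∧
      QuadSpace.IsIsotropic (QuadraticForm.baseChange S (q.restrict W))) ∧
    (∀ f : Polynomial R, IsUnit f.leadingCoeff → f.natDegree = n →
      ∀ e : AdjoinRoot f ≃ₐ[R] S,
        ∃ v : Fin n → V,
          QuadSpace.IsIsotropicVector (QuadraticForm.baseChange S q)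
            (∑ i : Fin n, (e (AdjoinRoot.root f) ^ (i : ℕ)) ⊗ₜ[R] v i) ∧
          QuadSpace.IsSubspaceOfRank q (Submodule.span R (Set.range v)) n) := by
  have : Nontrivial R := by
    by_contra h
    rw [not_nontrivial_iff_subsingleton] at h
    -- Over the zero ring `finrank` takes the value 1, contradicting `2 ≤ n < finrank R V`.
    have : Module.finrank R V = 1 := by simp [Module.finrank, rank_subsingleton]
    omega
  have hflat : Module.Flat R S := inferInstance
  constructor
  · obtain ⟨b⟩ := QuadSpace.nonempty_basis_of_rankAtStalk_eq n hS
    obtain ⟨v, -, hv, hv'⟩ := QuadSpace.exists_isotropic_subspace b (by simpa using hn) q hq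
      (by simpa using hV) hiso
    rw [Fintype.card_fin] at hv
    exact ⟨_, hv, hv'⟩
  · rintro f hf rfl e
    obtain ⟨b, hb⟩ := QuadSpace.exists_basis_eq_root_pow f hf
    obtain ⟨v, hv, hv', -⟩ := QuadSpace.exists_isotropic_subspace (b.map e.toLinearEquiv)
      (by simpa using hn) q hq (by simpa using hV) hiso
    rw [Fintype.card_fin] at hv'
    exact ⟨v, by simpa [hb] using hv, hv'⟩
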